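/- Work with untyped $\lambda$-terms modulo renaming of bound variables. $\to$ is one-step $\beta$-reduction and $\twoheadrightarrow$ its reflexive and transitive closure. Takahashi's translation is $x^*=x$, $((\lambda x.M)N)^*=M^*[x:=N^*]$, $(MN)^*=M^*N^*$ if $M$ is not an abstraction, $(\lambda x.M)^*=\lambda x.M^*$; and $M^{0*}=M$, $M^{(k+1)*}=(M^{k*})^*$. In a reduction path $M_0\to M_1\to\cdots\to M_n$ in which the step $M_i\to M_{i+1}$ contracts the redex occurrence $R_i$ of $M_i$, a redex occurrence of $M_{i+1}$ is called created if it is not a residual, with respect to the contraction of $R_i$, of any redex occurrence of $M_i$. The contracted redex $R_j$ is called new if, for some $1\le i\le j$, it is a residual (after the steps contracting $R_i,\dots,R_{j-1}$; for $i=j$ it is the redex itself) of a redex occurrence of $M_i$ created by the step $M_{i-1}\to M_i$. The path contains $k$ reductions of new redexes if exactly $k$ of the $R_0,\dots,R_{n-1}$ are new. **Theorem (Improved Church-Rosser theorem for $\beta$-reduction).** Let $P_n\leftarrow\cdots\leftarrow P_1\leftarrow M\to Q_1\to\cdots\to Q_m$ with $n,m\ge 0$ (where $P_0=Q_0=M$),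 and fix for each step the redex occurrence that it contracts. If the path $M\to P_1\to\cdots\to P_n$ contains $a$ reductions of new redexes and the path $M\to Q_1\to\cdots\to Q_m$ contains $b$ reductions of new redexes, then $$P_n\twoheadrightarrow Q_m^{(a+1)*}\qquad\text{and}\qquad Q_m\twoheadrightarrow P_n^{(b+1)*}.$$ -/

import Mathlib

namespace LambdaCalc

/-- Untyped `λ`-terms up to renaming of bound variables, in de Bruijn notation: `var i` is bound by
the `i`-th enclosing `lam` (counted from inside, from `0`) if there is one, and is a free variable
otherwise. -/
inductive Term : Type
  | var : ℕ → Term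
  | lam : Term → Term
  | app : Term → Term → Term

namespace Term

/-- Extension of a renaming under a binder. -/
def upRen (f : ℕ → ℕ) : ℕ → ℕ
  | 0 => 0
  | i + 1 => f i + 1

/-- Renaming of the free variables. -/
def rename : (ℕ → ℕ) → Term → Term
  | f, var i => var (f i)
  | f, lam s => lam (rename (upRen f) s)
  | f, app s t => app (rename f s) (rename f t)

/-- Extension of a substitution under a binder. -/
def upSubst (σ : ℕ → Term) : ℕ → Term
  | 0 => var 0
  | i + 1 => rename Nat.succ (σ i)

/-- Simultaneous capture-avoiding substitution for all free variables. -/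
def subst : (ℕ → Term) → Term → Term
  | σ, var i => σ i
  | σ, lam s => lam (subst (upSubst σ) s)
  | σ, app s t => app (subst σ s) (subst σ t)

/-- The substitution that sends variable `0` to `t` and lowers all other variables by one. -/
def single (t : Term) : ℕ → Term
  | 0 => t
  | i + 1 => var i

/-- `inst s t` is the contractum `s[x := t]` of the redex `(λ x. s) t`. -/
def inst (s t : Term) : Term := subst (single t) s

/-- Takahashi's translation `M*` (Gross–Knuth strategy). -/
def star : Term → Term
  | var i => var i
  | app (lam s) t => inst (star s) (star t)
  | app s t => app (star s) (star t)
  | lam s => lam (star s)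

/-- The iteration `M^{n*}` of the translation: `M^{0*} = M` and `M^{(n+1)*} = (M^{n*})*`. -/
def iterStar : ℕ → Term → Term
  | 0, M => M
  | n + 1, M => star (iterStar n M)

end Term

open Term

/-- One-step `β`-reduction. -/
inductive Beta : Term → Term → Prop
  | beta (s t : Term) : Beta (app (lam s) t) (inst s t)
  | lam {s s' : Term} : Beta s s' → Beta (lam s) (lam s')
  | appL {s s' : Term} (t : Term) : Beta s s' → Beta (app s t) (app s' t)
  | appR (s : Term) {t t' : Term} : Beta t t' → Beta (app s t) (app s t')

/-- Many-step `β`-reduction: the reflexive and transitive closure of `Beta`. -/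
def BetaStar : Term → Term → Prop := Relation.ReflTransGen Beta

/-- A direction in a term: to the body of an abstraction, or to the function part or the argument
part of an application. -/
inductive Dir : Type
  | body : Dir
  | fn : Dir
  | arg : Dir

/-- A position in a term, read from the root. Subterm occurrences are identified with positions;
`p <+: q` says that the occurrence at `q` is contained in the one at `p`. -/
abbrev Pos : Type := List Dir

/-- The subterm of a term at a position, if there is one. -/
def subtermAt : Term → Pos → Option Term
  | M, [] => some M
  | lam s, Dir.body :: p => subtermAt s p
  | app s _, Dir.fn :: p => subtermAt s p
  | app _ t, Dir.arg :: p => subtermAt t p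
  | _, _ :: _ => none

/-- The set of all redex occurrences in `M`. -/
def Redex (M : Term) : Set Pos := {p | ∃ s t : Term, subtermAt M p = some (app (lam s) t)}

/-- `Contract M p N`: the term `N` is obtained from `M` by contracting the redex occurrence `p`. -/
inductive Contract : Term → Pos → Term → Prop
  | beta (s t : Term) : Contract (app (lam s) t) [] (inst s t)
  | lam {s s' : Term} {p : Pos} : Contract s p s' → Contract (lam s) (Dir.body :: p) (lam s')
  | appL {s s' : Term} {p : Pos} (t : Term) :
      Contract s p s' → Contract (app s t) (Dir.fn :: p) (app s' t)
  | appR (s : Term) {t t' : Term} {p : Pos} :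
      Contract t p t' → Contract (app s t) (Dir.arg :: p) (app s t')

/-- `FreeAt k M u`: there is a free occurrence of the variable `k` in `M` at position `u`. -/
inductive FreeAt : ℕ → Term → Pos → Prop
  | var (k : ℕ) : FreeAt k (var k) []
  | lam {k : ℕ} {s : Term} {u : Pos} : FreeAt (k + 1) s u → FreeAt k (lam s) (Dir.body :: u)
  | appL {k : ℕ} {s : Term} (t : Term) {u : Pos} :
      FreeAt k s u → FreeAt k (app s t) (Dir.fn :: u)
  | appR {k : ℕ} (s : Term) {t : Term} {u : Pos} :
      FreeAt k t u → FreeAt k (app s t) (Dir.arg :: u)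

/-- `Residual M p q q'`: if the redex occurrence `p` of `M` is contracted, then the redex
occurrence `q` of `M` has the residual `q'` in the result. The redex `p` itself has none. -/
inductive Residual (M : Term) (p : Pos) : Pos → Pos → Prop
  /-- `q` and `p` are disjoint. -/
  | disjoint {q : Pos} : ¬ p <+: q → ¬ q <+: p → Residual M p q q
  /-- `q` properly contains `p`. -/
  | outside {q : Pos} : q <+: p → q ≠ p → Residual M p q q
  /-- `q` lies in the body `s` of the contracted redex `(λ x. s) t`, at position `r` of `s`;
  it becomes the subterm at position `r` of `s[x := t]`. -/
  | inBody (r : Pos) : Residual M p (p ++ Dir.fn :: Dir.body :: r) (p ++ r)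
  /-- `q` lies in the argument `t` of the contracted redex `(λ x. s) t`, at position `r` of `t`;
  it has one copy for every occurrence `u` of the bound variable `x` in `s`. -/
  | inArg {s t : Term} {u : Pos} (r : Pos) : subtermAt M p = some (app (lam s) t) →
      FreeAt 0 s u → Residual M p (p ++ Dir.arg :: r) (p ++ u ++ r)

/-- The set of residuals of a set `𝓡` of redex occurrences of `M` after contracting `p`. -/
def Res (M : Term) (p : Pos) (𝓡 : Set Pos) : Set Pos := {q' | ∃ q ∈ 𝓡, Residual M p q q'}

/-- `IsPath n M R`: the terms `M 0, …, M n` form a reduction path of length `n`, in which the step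
from `M i` to `M (i + 1)` contracts the redex occurrence `R i` (values beyond `n` play no role). -/
def IsPath (n : ℕ) (M : ℕ → Term) (R : ℕ → Pos) : Prop :=
  ∀ i < n, Contract (M i) (R i) (M (i + 1))

/-- The redex occurrences in `M i` that are created by the step from `M (i - 1)` to `M i`, that is,
are not residuals of redex occurrences in `M (i - 1)`; the initial term has none. -/
def NewRed (M : ℕ → Term) (R : ℕ → Pos) : ℕ → Set Pos
  | 0 => ∅
  | i + 1 => {q | q ∈ Redex (M (i + 1)) ∧ q ∉ Res (M i) (R i) (Redex (M i))}

/-- The residuals in `M (i + k)` of a set of redex occurrences in `M i`, after the `k` steps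
contracting `R i, …, R (i + k - 1)`. -/
def resAlong (M : ℕ → Term) (R : ℕ → Pos) (i : ℕ) (𝓡 : Set Pos) : ℕ → Set Pos
  | 0 => 𝓡
  | k + 1 => Res (M (i + k)) (R (i + k)) (resAlong M R i 𝓡 k)

/-- The redex `R j` contracted in `M j` is new: it is (a residual of) a redex occurrence that was
created at some `M i` with `i ≤ j`. -/
def IsNew (M : ℕ → Term) (R : ℕ → Pos) (j : ℕ) : Prop :=
  ∃ i k : ℕ, i + k = j ∧ R j ∈ resAlong M R i (NewRed M R i) k

/-- The number of steps of a path of length `n` that contract a new redex. -/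
noncomputable def newCount (n : ℕ) (M : ℕ → Term) (R : ℕ → Pos) : ℕ :=
  {j | j < n ∧ IsNew M R j}.ncard

end LambdaCalc

namespace LambdaCalc

namespace Term

/-! ### Algebra of substitutions -/

/-! Mark every redex of the initial term `M` and let residuals inherit the marks along the path. The
complete development of all marks is at first `M*`. Contracting a marked redex leaves the
development unchanged; contracting any other redex changes it by at most one parallel step
(`exists_lift`). By the triangle property the development then reduces to the translation of what it
was before, so each new redex costs one extra `*`. A step that is not new contracts a residual of an
initial redex, hence a marked one, and costs nothing. After `a` new steps the last term reduces to
its development, which reduces to `M^{(a+1)*}` (`IsPath.exists_marking`). Since `*` is monotone for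
many-step reduction (`BetaStar.star`), `M` reducing to `Q_m` turns this into a bound by
`Q_m^{(a+1)*}`; the other half is symmetric. -/

theorem rename_eq_subst (f : ℕ → ℕ) (s : Term) : rename f s = subst (fun i => var (f i)) s := by
  induction s generalizing f with
  | var i => rfl
  | lam s ih =>
    have h : upSubst (fun i => var (f i)) = fun i => var (upRen f i) := by
      funext i; cases i <;> rfl
    simp only [rename, subst, h, ih]
  | app s t ihs iht => simp only [rename, subst, ihs, iht]

theorem subst_rename (σ : ℕ → Term) (f : ℕ → ℕ) (s : Term) :
    subst σ (rename f s) = subst (fun i => σ (f i)) s := by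
  induction s generalizing σ f with
  | var i => rfl
  | lam s ih =>
    have h : (fun i => upSubst σ (upRen f i)) = upSubst (fun i => σ (f i)) := by
      funext i; cases i <;> rfl
    simp only [rename, subst, ih, h]
  | app s t ihs iht => simp only [rename, subst, ihs, iht]

theorem rename_rename (f g : ℕ → ℕ) (s : Term) :
    rename f (rename g s) = rename (fun i => f (g i)) s := by
  rw [rename_eq_subst f, subst_rename, ← rename_eq_subst]

theorem rename_subst (f : ℕ → ℕ) (σ : ℕ → Term) (s : Term) :
    rename f (subst σ s) = subst (fun i => rename f (σ i)) s := by
  induction s generalizing σ f with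
  | var i => rfl
  | lam s ih =>
    have h : (fun i => rename (upRen f) (upSubst σ i)) = upSubst (fun i => rename f (σ i)) := by
      funext i
      cases i with
      | zero => rfl
      | succ i => simp only [upSubst, rename_rename]; rfl
    simp only [rename, subst, ih, h]
  | app s t ihs iht => simp only [rename, subst, ihs, iht]

/-- Lifting under a binder renames, so the abstraction case rests on the two mixed laws
`subst_rename` and `rename_subst`, which therefore come first. -/
theorem subst_subst (τ σ : ℕ → Term) (s : Term) :
    subst τ (subst σ s) = subst (fun i => subst τ (σ i)) s := by
  induction s generalizing σ τ with
  | var i => rfl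
  | lam s ih =>
    have h : (fun i => subst (upSubst τ) (upSubst σ i)) = upSubst (fun i => subst τ (σ i)) := by
      funext i
      cases i with
      | zero => rfl
      | succ i => simp only [upSubst, subst_rename, rename_subst]
    simp only [subst, ih, h]
  | app s t ihs iht => simp only [subst, ihs, iht]

theorem subst_var (s : Term) : subst var s = s := by
  induction s with
  | var i => rfl
  | lam s ih =>
    have h : upSubst var = var := by funext i; cases i <;> rfl
    simp only [subst, h, ih]
  | app s t ihs iht => simp only [subst, ihs, iht]

theorem subst_inst (σ : ℕ → Term) (s t : Term) :
    subst σ (inst s t) = inst (subst (upSubst σ) s) (subst σ t) := by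
  simp only [inst, subst_subst]
  congr 1
  funext i
  cases i with
  | zero => rfl
  | succ i =>
    simp only [single, upSubst, subst, subst_rename]
    exact (subst_var _).symm

theorem rename_inst (f : ℕ → ℕ) (s t : Term) :
    rename f (inst s t) = inst (rename (upRen f) s) (rename f t) := by
  simp only [inst, rename_subst, subst_rename]
  congr 1
  funext i
  cases i <;> rfl

end Term

open Term

/-! ### Parallel reduction -/

/-- Parallel `β`-reduction. -/
inductive Par : Term → Term → Prop
  | var (i : ℕ) : Par (var i) (var i)
  | lam {s s' : Term} : Par s s' → Par (lam s) (lam s')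
  | app {s s' t t' : Term} : Par s s' → Par t t' → Par (app s t) (app s' t')
  | beta {s s' t t' : Term} : Par s s' → Par t t' → Par (app (lam s) t) (inst s' t')

theorem Par.refl (s : Term) : Par s s := by
  induction s with
  | var i => exact .var i
  | lam s ih => exact .lam ih
  | app s t ihs iht => exact .app ihs iht

theorem Par.rename {s s' : Term} (h : Par s s') (f : ℕ → ℕ) :
    Par (Term.rename f s) (Term.rename f s') := by
  induction h generalizing f with
  | var i => exact .var _
  | lam _ ih => exact .lam (ih _)
  | app _ _ ihs iht => exact .app (ihs f) (iht f)
  | beta _ _ ihs iht =>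
    rw [rename_inst]
    exact .beta (ihs _) (iht f)

theorem Par.upSubst {σ τ : ℕ → Term} (h : ∀ i, Par (σ i) (τ i)) (i : ℕ) :
    Par (Term.upSubst σ i) (Term.upSubst τ i) := by
  cases i with
  | zero => exact .var 0
  | succ i => exact (h i).rename _

theorem Par.subst {s s' : Term} (h : Par s s') {σ τ : ℕ → Term} (hσ : ∀ i, Par (σ i) (τ i)) :
    Par (Term.subst σ s) (Term.subst τ s') := by
  induction h generalizing σ τ with
  | var i => exact hσ i
  | lam _ ih => exact .lam (ih (Par.upSubst hσ))
  | app _ _ ihs iht => exact .app (ihs hσ) (iht hσ)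
  | beta _ _ ihs iht =>
    rw [subst_inst]
    exact .beta (ihs (Par.upSubst hσ)) (iht hσ)

theorem Par.inst {s s' t t' : Term} (hs : Par s s') (ht : Par t t') :
    Par (Term.inst s t) (Term.inst s' t') := by
  refine hs.subst fun i => ?_
  cases i with
  | zero => exact ht
  | succ i => exact .var i

theorem star_app_of_ne_lam {s : Term} (t : Term) (h : ∀ u, s ≠ lam u) :
    star (app s t) = app (star s) (star t) := by
  cases s with
  | lam u => exact absurd rfl (h u)
  | var i => simp only [Term.star]
  | app u v => rw [Term.star]; simp

/-- Takahashi's triangle property. -/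
theorem Par.triangle {s s' : Term} (h : Par s s') : Par s' (star s) := by
  induction h with
  | var i => exact .var i
  | lam _ ih => simpa only [Term.star] using Par.lam ih
  | @app s s' t t' hs _ ihs iht =>
    -- The application rule may leave a redex at the root uncontracted, while `star` contracts it.
    -- The reduct of its function part is still an abstraction, so the `beta` rule can catch up.
    by_cases hl : ∃ u, s = Term.lam u
    · obtain ⟨u, hu⟩ := hl
      subst hu
      cases hs
      simp only [Term.star] at ihs ⊢
      cases ihs with
      | lam ihs => exact .beta ihs iht
    · rw [star_app_of_ne_lam t fun u hu => hl ⟨u, hu⟩]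
      exact .app ihs iht
  | beta _ _ ihs iht =>
    simp only [Term.star]
    exact ihs.inst iht

theorem Beta.par {s s' : Term} (h : Beta s s') : Par s s' := by
  induction h with
  | beta s t => exact .beta (.refl s) (.refl t)
  | lam _ ih => exact .lam ih
  | appL t _ ih => exact .app ih (.refl t)
  | appR s _ ih => exact .app (.refl s) ih

theorem BetaStar.lam {s s' : Term} (h : BetaStar s s') : BetaStar (.lam s) (.lam s') :=
  Relation.ReflTransGen.lift Term.lam (fun _ _ => Beta.lam) _ _ h

theorem BetaStar.app {s s' t t' : Term} (hs : BetaStar s s') (ht : BetaStar t t') :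
    BetaStar (.app s t) (.app s' t') :=
  (Relation.ReflTransGen.lift (Term.app · t) (fun _ _ => Beta.appL t) _ _ hs).trans
    (Relation.ReflTransGen.lift (Term.app s') (fun _ _ => Beta.appR s') _ _ ht)

theorem Par.betaStar {s s' : Term} (h : Par s s') : BetaStar s s' := by
  induction h with
  | var i => exact .refl
  | lam _ ih => exact ih.lam
  | app _ _ ihs iht => exact ihs.app iht
  | beta _ _ ihs iht => exact Relation.ReflTransGen.tail (ihs.lam.app iht) (.beta _ _)

/-- For one step from `M` to `N`, the triangle property applied twice gives parallel steps from `N`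
to `M*` and from `M*` to `N*`. -/
theorem BetaStar.star {s s' : Term} (h : BetaStar s s') :
    BetaStar (Term.star s) (Term.star s') := by
  induction h with
  | refl => exact .refl
  | tail _ hb ih => exact ih.trans hb.par.triangle.triangle.betaStar

theorem BetaStar.iterStar {s s' : Term} (h : BetaStar s s') (k : ℕ) :
    BetaStar (Term.iterStar k s) (Term.iterStar k s') := by
  induction k with
  | zero => exact h
  | succ k ih => exact ih.star

/-! ### Terms with marked redexes -/

/-- Terms in which some redexes are marked: `red s t` is a marked redex `(λ x. s) t`. -/
inductive MTerm : Type
  | var : ℕ → MTerm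
  | lam : MTerm → MTerm
  | app : MTerm → MTerm → MTerm
  | red : MTerm → MTerm → MTerm

namespace MTerm

/-- The underlying term. -/
def erase : MTerm → Term
  | var i => .var i
  | lam s => .lam (erase s)
  | app s t => .app (erase s) (erase t)
  | red s t => .app (.lam (erase s)) (erase t)

/-- The result of the complete development of the marked redexes. -/
def dev : MTerm → Term
  | var i => .var i
  | lam s => .lam (dev s)
  | app s t => .app (dev s) (dev t)
  | red s t => inst (dev s) (dev t)

/-- Renaming of the free variables. -/
def rename : (ℕ → ℕ) → MTerm → MTerm
  | f, var i => var (f i)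
  | f, lam s => lam (rename (upRen f) s)
  | f, app s t => app (rename f s) (rename f t)
  | f, red s t => red (rename (upRen f) s) (rename f t)

/-- Extension of a substitution under a binder. -/
def upSubst (σ : ℕ → MTerm) : ℕ → MTerm
  | 0 => var 0
  | i + 1 => rename Nat.succ (σ i)

/-- Simultaneous substitution for all free variables. -/
def subst : (ℕ → MTerm) → MTerm → MTerm
  | σ, var i => σ i
  | σ, lam s => lam (subst (upSubst σ) s)
  | σ, app s t => app (subst σ s) (subst σ t)
  | σ, red s t => red (subst (upSubst σ) s) (subst σ t)

/-- The substitution that sends variable `0` to `t` and lowers all other variables by one. -/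
def single (t : MTerm) : ℕ → MTerm
  | 0 => t
  | i + 1 => var i

/-- The contractum of the (marked or unmarked) redex `(λ x. s) t`. -/
def inst (s t : MTerm) : MTerm := subst (single t) s

/-- `Marked T p`: there is a marked redex at position `p`. -/
inductive Marked : MTerm → Pos → Prop
  | here (s t : MTerm) : Marked (red s t) []
  | lam {s : MTerm} {p : Pos} : Marked s p → Marked (lam s) (Dir.body :: p)
  | appL {s : MTerm} (t : MTerm) {p : Pos} : Marked s p → Marked (app s t) (Dir.fn :: p)
  | appR (s : MTerm) {t : MTerm} {p : Pos} : Marked t p → Marked (app s t) (Dir.arg :: p)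
  | redL {s : MTerm} (t : MTerm) {p : Pos} :
      Marked s p → Marked (red s t) (Dir.fn :: Dir.body :: p)
  | redR (s : MTerm) {t : MTerm} {p : Pos} : Marked t p → Marked (red s t) (Dir.arg :: p)

/-- The marking of all redexes of a term. -/
def markAll : Term → MTerm
  | .var i => var i
  | .app (.lam s) t => red (markAll s) (markAll t)
  | .app s t => app (markAll s) (markAll t)
  | .lam s => lam (markAll s)

theorem markAll_app_of_ne_lam {s : Term} (t : Term) (h : ∀ u, s ≠ .lam u) :
    markAll (.app s t) = app (markAll s) (markAll t) := by
  cases s with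
  | lam u => exact absurd rfl (h u)
  | var i => simp only [markAll]
  | app u v => rw [markAll]; simp

theorem erase_markAll (M : Term) : erase (markAll M) = M := by
  fun_induction markAll M <;> simp_all [erase]

theorem dev_markAll (M : Term) : dev (markAll M) = star M := by
  fun_induction markAll M with
  | case1 i => rfl
  | case2 s t ihs iht => simp only [dev, Term.star, ihs, iht]
  | case3 s t h ihs iht => rw [star_app_of_ne_lam t h, dev, ihs, iht]
  | case4 s ih => simp only [dev, Term.star, ih]

theorem marked_markAll {M : Term} {p : Pos} (h : p ∈ Redex M) : Marked (markAll M) p := by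
  obtain ⟨u, v, h⟩ := h
  fun_induction markAll M generalizing p with
  | case1 i => cases p <;> simp [subtermAt] at h
  | case2 s t ihs iht =>
    match p, h with
    | [], _ => exact .here _ _
    | [Dir.fn], h => simp [subtermAt] at h
    | Dir.fn :: Dir.body :: p, h => exact .redL _ (ihs h)
    | Dir.fn :: Dir.fn :: p, h => simp [subtermAt] at h
    | Dir.fn :: Dir.arg :: p, h => simp [subtermAt] at h
    | Dir.arg :: p, h => exact .redR _ (iht h)
    | Dir.body :: p, h => simp [subtermAt] at h
  | case3 s t hs ihs iht =>
    match p, h with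
    | [], h =>
      simp only [subtermAt, Option.some.injEq, Term.app.injEq] at h
      exact absurd h.1 (hs u)
    | Dir.fn :: p, h => exact .appL _ (ihs h)
    | Dir.arg :: p, h => exact .appR _ (iht h)
    | Dir.body :: p, h => simp [subtermAt] at h
  | case4 s ih =>
    match p, h with
    | [], h => simp [subtermAt] at h
    | Dir.body :: p, h => exact .lam (ih h)
    | Dir.fn :: p, h => simp [subtermAt] at h
    | Dir.arg :: p, h => simp [subtermAt] at h

theorem erase_rename (f : ℕ → ℕ) (s : MTerm) : erase (rename f s) = (erase s).rename f := by
  induction s generalizing f <;> simp_all [erase, rename, Term.rename]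

theorem dev_rename (f : ℕ → ℕ) (s : MTerm) : dev (rename f s) = (dev s).rename f := by
  induction s generalizing f <;> simp_all [dev, rename, Term.rename, rename_inst]

theorem erase_upSubst (σ : ℕ → MTerm) :
    (fun i => erase (upSubst σ i)) = Term.upSubst (fun i => erase (σ i)) := by
  funext i
  cases i with
  | zero => rfl
  | succ i => exact erase_rename _ _

theorem dev_upSubst (σ : ℕ → MTerm) :
    (fun i => dev (upSubst σ i)) = Term.upSubst (fun i => dev (σ i)) := by
  funext i
  cases i with
  | zero => rfl
  | succ i => exact dev_rename _ _

theorem erase_subst (σ : ℕ → MTerm) (s : MTerm) :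
    erase (subst σ s) = (erase s).subst (fun i => erase (σ i)) := by
  induction s generalizing σ <;> simp_all [erase, subst, Term.subst, erase_upSubst]

theorem dev_subst (σ : ℕ → MTerm) (s : MTerm) :
    dev (subst σ s) = (dev s).subst (fun i => dev (σ i)) := by
  induction s generalizing σ <;> simp_all [dev, subst, Term.subst, dev_upSubst, subst_inst]

theorem erase_inst (s t : MTerm) : erase (inst s t) = Term.inst (erase s) (erase t) := by
  rw [inst, erase_subst, Term.inst]
  congr 1
  funext i
  cases i <;> rfl

theorem dev_inst (s t : MTerm) : dev (inst s t) = Term.inst (dev s) (dev t) := by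
  rw [inst, dev_subst, Term.inst]
  congr 1
  funext i
  cases i <;> rfl

theorem par_erase_dev (s : MTerm) : Par (erase s) (dev s) := by
  induction s with
  | var i => exact .var i
  | lam s ih => exact .lam ih
  | app s t ihs iht => exact .app ihs iht
  | red s t ihs iht => exact .beta ihs iht

theorem Marked.rename {s : MTerm} {p : Pos} (h : Marked s p) (f : ℕ → ℕ) :
    Marked (MTerm.rename f s) p := by
  induction h generalizing f with
  | here s t => exact .here _ _
  | lam _ ih => exact .lam (ih _)
  | appL t _ ih => exact .appL _ (ih _)
  | appR s _ ih => exact .appR _ (ih _)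
  | redL t _ ih => exact .redL _ (ih _)
  | redR s _ ih => exact .redR _ (ih _)

/-- Substitution only replaces leaves, so marks keep their positions; this covers residuals in the
body of a contracted redex. -/
theorem Marked.subst {s : MTerm} {p : Pos} (h : Marked s p) (σ : ℕ → MTerm) :
    Marked (MTerm.subst σ s) p := by
  induction h generalizing σ with
  | here s t => exact .here _ _
  | lam _ ih => exact .lam (ih _)
  | appL t _ ih => exact .appL _ (ih _)
  | appR s _ ih => exact .appR _ (ih _)
  | redL t _ ih => exact .redL _ (ih _)
  | redR s _ ih => exact .redR _ (ih _)

/-- Covers residuals in the argument: each occurrence of the bound variable receives a copy with all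
its marks. The variable `k` is arbitrary because it shifts under binders. -/
theorem Marked.subst_of_freeAt {s : MTerm} {k : ℕ} {u r : Pos} {σ : ℕ → MTerm}
    (hu : FreeAt k (erase s) u) (hr : Marked (σ k) r) : Marked (MTerm.subst σ s) (u ++ r) := by
  induction s generalizing k u σ with
  | var i => cases hu; exact hr
  | lam s ih =>
    cases hu with
    | lam hu => exact .lam (ih hu (σ := MTerm.upSubst σ) (hr.rename _))
  | app s t ihs iht =>
    cases hu with
    | appL _ hu => exact .appL _ (ihs hu hr)
    | appR _ hu => exact .appR _ (iht hu hr)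
  | red s t ihs iht =>
    cases hu with
    | appL _ hu =>
      cases hu with
      | lam hu => exact .redL _ (ihs hu (σ := MTerm.upSubst σ) (hr.rename _))
    | appR _ hu => exact .redR _ (iht hu hr)

end MTerm

/-! ### Residuals -/

/-- Residuals after the contraction of a redex that is not at the root. -/
theorem Residual.of_cons {M : Term} {d : Dir} {p q q' : Pos} (h : Residual M (d :: p) q q')
    {N : Term} (hN : ∀ r, subtermAt M (d :: r) = subtermAt N r) :
    (∃ r r', q = d :: r ∧ q' = d :: r' ∧ Residual N p r r') ∨ ((∀ r, q ≠ d :: r) ∧ q' = q) := by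
  cases h with
  | disjoint h₁ h₂ =>
    by_cases hq : ∃ r, q = d :: r
    · obtain ⟨r, rfl⟩ := hq
      simp only [List.cons_prefix_cons, true_and] at h₁ h₂
      exact .inl ⟨r, r, rfl, rfl, .disjoint h₁ h₂⟩
    · exact .inr ⟨fun r hr => hq ⟨r, hr⟩, rfl⟩
  | outside h₁ h₂ =>
    by_cases hq : ∃ r, q = d :: r
    · obtain ⟨r, rfl⟩ := hq
      simp only [List.cons_prefix_cons, true_and] at h₁
      exact .inl ⟨r, r, rfl, rfl, .outside h₁ fun h => h₂ (by rw [h])⟩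
    · exact .inr ⟨fun r hr => hq ⟨r, hr⟩, rfl⟩
  | inBody r => exact .inl ⟨_, _, rfl, rfl, .inBody r⟩
  | inArg r h₁ h₂ => exact .inl ⟨_, _, rfl, rfl, .inArg r ((hN p).symm.trans h₁) h₂⟩

/-- Residuals after the contraction of a redex at the root. -/
theorem Residual.of_nil {s t : Term} {q q' : Pos} (h : Residual (app (lam s) t) [] q q') :
    q = Dir.fn :: Dir.body :: q' ∨
      ∃ u r, FreeAt 0 s u ∧ q = Dir.arg :: r ∧ q' = u ++ r := by
  cases h with
  | disjoint h₁ _ => exact absurd List.nil_prefix h₁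
  | outside h₁ h₂ => exact absurd (List.prefix_nil.mp h₁) h₂
  | inBody r => exact .inl rfl
  | inArg r h₁ h₂ =>
    simp only [subtermAt, Option.some.injEq, Term.app.injEq, Term.lam.injEq] at h₁
    obtain ⟨rfl, rfl⟩ := h₁
    exact .inr ⟨_, r, h₂, rfl, rfl⟩

namespace MTerm

/-- The assumptions speak of body and argument separately, so that they fit a root redex whether it
is marked or not. -/
theorem Marked.inst_of_residual {s t : MTerm} {q q' : Pos}
    (hs : ∀ r, q = Dir.fn :: Dir.body :: r → Marked s r) (ht : ∀ r, q = Dir.arg :: r → Marked t r)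
    (h : Residual (.app (.lam (erase s)) (erase t)) [] q q') : Marked (inst s t) q' := by
  rcases h.of_nil with hq | ⟨u, r, hu, hq, rfl⟩
  · exact (hs _ hq).subst _
  · exact Marked.subst_of_freeAt hu (σ := single t) (ht _ hq)

/-- A contraction step lifts to marked terms. The marks are inherited by residuals, and the complete
developments before and after the step are equal if the contracted redex is marked, and related by
parallel reduction in any case. -/
theorem exists_lift (T : MTerm) {p : Pos} {N : Term} (h : Contract (erase T) p N) :
    ∃ T' : MTerm, erase T' = N ∧
      (∀ q q', Marked T q → Residual (erase T) p q q' → Marked T' q') ∧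
      Par (dev T) (dev T') ∧ (Marked T p → dev T' = dev T) := by
  induction T generalizing p N with
  | var i => cases h
  | lam s ih =>
    cases h with
    | lam h =>
      obtain ⟨s', rfl, hr, hp, hd⟩ := ih h
      refine ⟨lam s', rfl, fun q q' hq hqq => ?_, .lam hp, fun hm => ?_⟩
      · cases hq with
        | lam hq =>
          rcases hqq.of_cons (N := erase s) fun _ => rfl with ⟨r, r', h₁, rfl, h₂⟩ | ⟨h₁, _⟩
          · cases h₁
            exact .lam (hr _ _ hq h₂)
          · exact absurd rfl (h₁ _)
      · cases hm with
        | lam hm => simp only [dev, hd hm]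
  | app s t ihs iht =>
    simp only [erase] at h
    generalize hs : erase s = s₀ at h
    generalize ht : erase t = t₀ at h
    cases h with
    | beta u v =>
      subst ht
      cases s with
      | lam u' =>
        cases hs
        refine ⟨inst u' t, erase_inst _ _, fun q q' hq hqq => ?_, ?_, fun hm => by cases hm⟩
        · refine Marked.inst_of_residual (fun r hr => ?_) (fun r hr => ?_) hqq
          · subst hr
            cases hq with
            | appL _ hq => cases hq; assumption
          · subst hr
            cases hq; assumption
        · rw [dev_inst]
          exact .beta (.refl _) (.refl _)
      -- Only `lam` erases to an abstraction.
      | _ => simp [erase] at hs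
    | appL _ h =>
      subst hs ht
      obtain ⟨s', rfl, hr, hp, hd⟩ := ihs h
      refine ⟨app s' t, rfl, fun q q' hq hqq => ?_, .app hp (.refl _), fun hm => ?_⟩
      · rcases hqq.of_cons (N := erase s) fun _ => rfl with ⟨r, r', rfl, rfl, h₂⟩ | ⟨h₁, rfl⟩
        · cases hq with
          | appL _ hq => exact .appL _ (hr _ _ hq h₂)
        · cases hq with
          | appL _ hq => exact absurd rfl (h₁ _)
          | appR _ hq => exact .appR _ hq
      · cases hm with
        | appL _ hm => simp only [dev, hd hm]
    | appR _ h =>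
      subst hs ht
      obtain ⟨t', rfl, hr, hp, hd⟩ := iht h
      refine ⟨app s t', rfl, fun q q' hq hqq => ?_, .app (.refl _) hp, fun hm => ?_⟩
      · rcases hqq.of_cons (N := erase t) fun _ => rfl with ⟨r, r', rfl, rfl, h₂⟩ | ⟨h₁, rfl⟩
        · cases hq with
          | appR _ hq => exact .appR _ (hr _ _ hq h₂)
        · cases hq with
          | appL _ hq => exact .appL _ hq
          | appR _ hq => exact absurd rfl (h₁ _)
      · cases hm with
        | appR _ hm => simp only [dev, hd hm]
  | red s t ihs iht =>
    cases h with
    | beta _ _ =>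
      refine ⟨inst s t, erase_inst _ _, fun q q' hq hqq => ?_, ?_, fun _ => dev_inst _ _⟩
      · refine Marked.inst_of_residual (fun r hr => ?_) (fun r hr => ?_) hqq
        · subst hr
          cases hq; assumption
        · subst hr
          cases hq; assumption
      · rw [dev_inst]
        exact .refl _
    | appL _ h =>
      cases h with
      | lam h =>
        obtain ⟨s', rfl, hr, hp, hd⟩ := ihs h
        refine ⟨red s' t, rfl, fun q q' hq hqq => ?_, hp.inst (.refl _), fun hm => ?_⟩
        -- The contracted position starts with two directions, `fn` and `body`, hence the two
        -- peelings. No mark sits on the abstraction between them.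
        · rcases hqq.of_cons (N := .lam (erase s)) fun _ => rfl with
            ⟨r, r', rfl, rfl, h₂⟩ | ⟨h₁, rfl⟩
          · rcases h₂.of_cons (N := erase s) fun _ => rfl with ⟨w, w', rfl, rfl, h₃⟩ | ⟨h₁, rfl⟩
            · cases hq with
              | redL _ hq => exact .redL _ (hr _ _ hq h₃)
            · cases hq with
              | redL _ hq => exact absurd rfl (h₁ _)
          · cases hq with
            | here => exact .here _ _
            | redL _ hq => exact absurd rfl (h₁ _)
            | redR _ hq => exact .redR _ hq
        · cases hm with
          | redL _ hm => simp only [dev, hd hm]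
    | appR _ h =>
      obtain ⟨t', rfl, hr, hp, hd⟩ := iht h
      refine ⟨red s t', rfl, fun q q' hq hqq => ?_, (Par.refl _).inst hp, fun hm => ?_⟩
      · rcases hqq.of_cons (N := erase t) fun _ => rfl with ⟨r, r', rfl, rfl, h₂⟩ | ⟨h₁, rfl⟩
        · cases hq with
          | redR _ hq => exact .redR _ (hr _ _ hq h₂)
        · cases hq with
          | here => exact .here _ _
          | redL _ hq => exact .redL _ hq
          | redR _ hq => exact absurd rfl (h₁ _)
      · cases hm with
        | redR _ hm => simp only [dev, hd hm]

end MTerm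

/-! ### Reduction paths -/

theorem Contract.to_beta {M N : Term} {p : Pos} (h : Contract M p N) : Beta M N := by
  induction h with
  | beta s t => exact .beta s t
  | lam _ ih => exact .lam ih
  | appL t _ ih => exact .appL t ih
  | appR s _ ih => exact .appR s ih

theorem Contract.mem_redex {M N : Term} {p : Pos} (h : Contract M p N) : p ∈ Redex M := by
  induction h with
  | beta s t => exact ⟨s, t, rfl⟩
  | lam _ ih => exact ih
  | appL t _ ih => exact ih
  | appR s _ ih => exact ih

theorem IsPath.betaStar {n : ℕ} {M : ℕ → Term} {R : ℕ → Pos} (h : IsPath n M R) :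
    BetaStar (M 0) (M n) := by
  induction n with
  | zero => exact .refl
  | succ n ih =>
    exact Relation.ReflTransGen.tail (ih fun i hi => h i (by omega)) (h n n.lt_succ_self).to_beta

/-- Every redex occurrence on a path is a residual of one in the initial term or of a created
one. -/
theorem mem_resAlong_of_mem_redex (M : ℕ → Term) (R : ℕ → Pos) {j : ℕ} {q : Pos}
    (hq : q ∈ Redex (M j)) :
    q ∈ resAlong M R 0 (Redex (M 0)) j ∨ ∃ i k, i + k = j ∧ q ∈ resAlong M R i (NewRed M R i) k := by
  induction j generalizing q with
  | zero => exact .inl hq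
  | succ j ih =>
    by_cases hres : q ∈ Res (M j) (R j) (Redex (M j))
    · obtain ⟨q₀, hq₀, hr⟩ := hres
      rcases ih hq₀ with h | ⟨i, k, rfl, h⟩
      · refine .inl ?_
        simp only [resAlong, Nat.zero_add]
        exact ⟨q₀, h, hr⟩
      · exact .inr ⟨i, k + 1, rfl, q₀, h, hr⟩
    · exact .inr ⟨j + 1, 0, rfl, hq, hres⟩

open Classical in
theorem newCount_succ (n : ℕ) (M : ℕ → Term) (R : ℕ → Pos) :
    newCount (n + 1) M R = newCount n M R + if IsNew M R n then 1 else 0 := by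
  -- `ncard` counts correctly only for finite sets.
  have hfin : {j | j < n ∧ IsNew M R j}.Finite := (Set.finite_lt_nat n).subset fun _ h => h.1
  unfold newCount
  split_ifs with hn
  · rw [← Set.ncard_insert_of_notMem (a := n) (fun h => lt_irrefl _ h.1) hfin]
    congr 1
    ext j
    simp only [Set.mem_ofPred_eq, Set.mem_insert_iff, Nat.lt_succ_iff_lt_or_eq]
    grind
  · congr 1
    ext j
    simp only [Set.mem_ofPred_eq, Nat.lt_succ_iff_lt_or_eq]
    grind

/-- Marking the redexes of the initial term of a path, the complete development of their residuals in
the last term reduces to the translation of the initial term, iterated once more than the path has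
reductions of new redexes. -/
theorem IsPath.exists_marking {n : ℕ} {M : ℕ → Term} {R : ℕ → Pos} (h : IsPath n M R) :
    ∃ T : MTerm, T.erase = M n ∧ (∀ q ∈ resAlong M R 0 (Redex (M 0)) n, T.Marked q) ∧
      BetaStar T.dev (iterStar (newCount n M R + 1) (M 0)) := by
  induction n with
  | zero =>
    refine ⟨.markAll (M 0), MTerm.erase_markAll _, fun q hq => MTerm.marked_markAll hq, ?_⟩
    rw [MTerm.dev_markAll]
    simp only [newCount, Nat.not_lt_zero, false_and, Set.ofPred_false, Set.ncard_empty]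
    exact .refl
  | succ n ih =>
    obtain ⟨T, hT, hm, hd⟩ := ih fun i hi => h i (by omega)
    have hc := h n n.lt_succ_self
    rw [← hT] at hc
    obtain ⟨T', hT', hm', hpar, heq⟩ := T.exists_lift hc
    refine ⟨T', hT', ?_, ?_⟩
    · intro q hq
      simp only [resAlong, Nat.zero_add] at hq
      obtain ⟨q₀, hq₀, hr⟩ := hq
      rw [← hT] at hr
      exact hm' _ _ (hm _ hq₀) hr
    · rw [newCount_succ]
      split_ifs with hnew
      -- The new development is a parallel reduct of the old one, so it reduces to the translation
      -- of the old one; monotonicity of `star` does the rest.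
      · exact hpar.triangle.betaStar.trans hd.star
      -- The contracted redex descends from the initial term, so it is marked and the development
      -- does not change.
      · rcases mem_resAlong_of_mem_redex M R (h n n.lt_succ_self).mem_redex with hold | hn
        · rw [heq (hm _ hold)]
          exact hd
        · exact absurd hn hnew

/-- The last term of a path with `k` reductions of new redexes reduces to the `(k + 1)`-fold
translation of the initial term. -/
theorem IsPath.betaStar_iterStar {n : ℕ} {M : ℕ → Term} {R : ℕ → Pos} (h : IsPath n M R) :
    BetaStar (M n) (iterStar (newCount n M R + 1) (M 0)) := by
  obtain ⟨T, hT, -, hd⟩ := h.exists_marking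
  rw [← hT]
  exact T.par_erase_dev.betaStar.trans hd

end LambdaCalc

theorem theorem2 (M : LambdaCalc.Term) (n m : ℕ)
    (P : ℕ → LambdaCalc.Term) (R : ℕ → LambdaCalc.Pos)
    (hP0 : P 0 = M) (hP : LambdaCalc.IsPath n P R)
    (Q : ℕ → LambdaCalc.Term) (S : ℕ → LambdaCalc.Pos)
    (hQ0 : Q 0 = M) (hQ : LambdaCalc.IsPath m Q S)
    (a b : ℕ)
    (ha : LambdaCalc.newCount n P R = a) (hb : LambdaCalc.newCount m Q S = b) :
    LambdaCalc.BetaStar (P n) (LambdaCalc.Term.iterStar (a + 1) (Q m)) ∧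
    LambdaCalc.BetaStar (Q m) (LambdaCalc.Term.iterStar (b + 1) (P n)) := by
  subst hP0 ha hb
  have hPQ := hQ.betaStar
  have hPs := hP.betaStar_iterStar
  have hQs := hQ.betaStar_iterStar
  rw [hQ0] at hPQ hQs
  exact ⟨hPs.trans (hPQ.iterStar _), hQs.trans (hP.betaStar.iterStar _)⟩
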